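/- Let $\mathcal{A}=(S,L,\eta,\ell)$ be a probabilistic automaton: $S$ is a non-empty finite set of states, $L$ a finite set of labels, $\ell\colon S\to L$ a labelling, and $\eta\colon S\to\mathcal{P}(D)$ assigns to each state a (possibly empty) set of distributions taken from a finite set $D$ of probability distributions on $S$. Throughout $\min\emptyset=1$, $\max\emptyset=0$ in $[0,1]$, and $x\ominus y=\max\{0,x-y\}$. For $p,q\in D$ let $\Omega(p,q)$ be the set of couplings of $p$ and $q$, i.e. of probability distributions on $S\times S$ with marginals $p$ and $q$, and $\mathit{supp}(c)=\{(u,v)\mid c(u,v)>0\}$. For $d\colon S\times S\to[0,1]$ put \[\mathcal{K}(d)(p,q)=\min_{c\in\Omega(p,q)}\sum_{u,v\in S}c(u,v)\,d(u,v)\qquad(p,q\in D),\] for $e\colon D\times D\to[0,1]$ and $P,Q\subseteq D$ put \[\mathcal{H}(e)(P,Q)=\max\{\max_{p\in P}\min_{q\in Q}e(p,q),\ \max_{q\in Q}\min_{p\in P}e(p,q)\},\] and let $\mathcal{M}(d)(s,t)=1$ if $\ell(s)\neq\ell(t)$, and $\mathcal{M}(d)(s,t)=\mathcal{H}(\mathcal{K}(d))(\eta(s),\eta(t))$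 otherwise. For finite sets $Y,Z$ and a function $f\colon[0,1]^Y\to[0,1]^Z$ that is non-expansive (i.e. $\max_{z}(f(b)(z)\ominus f(a)(z))\le\max_{y}(b(y)\ominus a(y))$ for all $a,b$), and for $a\in[0,1]^Y$, the approximation $f_\#^a\colon\mathcal{P}([Y]^a)\to\mathcal{P}([Z]^{f(a)})$ in the dual sense is defined as follows. Let $[Y]^a=\{y\in Y\mid a(y)\neq0\}$ and $\delta^a=\min\{a(y)\mid y\in[Y]^a\}$. For $\theta\in[0,1]$ and $Y'\subseteq[Y]^a$ let $a\ominus\theta_{Y'}$ be the function obtained from $a$ by replacing $a(y)$ with $a(y)\ominus\theta$ for $y\in Y'$, and let $f_\#^{a,\theta}(Y')=\{z\in[Z]^{f(a)}\mid f(a)(z)\ominus f(a\ominus\theta_{Y'})(z)\ge\theta\}$. For $z\in[Z]^{f(a)}$ let $\iota(Y',z)$ be the largest $\theta$ with $z\in f_\#^{a,\theta}(Y')$, and let $\iota$ be the minimum of $\delta^a$ and of all nonzero values $\iota(Y',z)$. Then $f_\#^a=f_\#^{a,\iota}$. A relation $M\subseteq S\times S$ is self-closed with respect to $d=\mathcal{M}(d)$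 if, whenever $(s,t)\in M$: (i) $\ell(s)=\ell(t)$ and $d(s,t)>0$; (ii) if $p\in\eta(s)$ and $d(s,t)=\min_{q'\in\eta(t)}\mathcal{K}(d)(p,q')$, then there are $q\in\eta(t)$ and $c\in\Omega(p,q)$ with $d(s,t)=\sum_{u,v\in S}d(u,v)\,c(u,v)$ and $\mathit{supp}(c)\subseteq M$; (iii) if $q\in\eta(t)$ and $d(s,t)=\min_{p'\in\eta(s)}\mathcal{K}(d)(p',q)$, then there are $p\in\eta(s)$ and $c\in\Omega(p,q)$ with $d(s,t)=\sum_{u,v\in S}d(u,v)\,c(u,v)$ and $\mathit{supp}(c)\subseteq M$. Proposition. The function $\mathcal{M}$ is non-expansive, and $\mathcal{M}=\max_\rho\circ(((\eta\times\eta)^*\circ\mathcal{H}\circ\mathcal{K})\uplus c_l)$, that is, $\mathcal{M}(d)(s,t)=\max\{\mathcal{H}(\mathcal{K}(d))(\eta(s),\eta(t)),\,l(s,t)\}$ where $l(s,t)=0$ if $\ell(s)=\ell(t)$ and $l(s,t)=1$ otherwise. Let $d\colon S\times S\to[0,1]$ with $d=\mathcal{M}(d)$. Then $[S\times S]^d=\{(s,t)\mid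 d(s,t)>0\}$, the approximation is an endo-function $\mathcal{M}_\#^d\colon\mathcal{P}([S\times S]^d)\to\mathcal{P}([S\times S]^d)$, and for every $M\subseteq S\times S$: $M$ is self-closed with respect to $d$ if and only if $M\subseteq[S\times S]^d$ and $M$ is a post-fixpoint of $\mathcal{M}_\#^d$, i.e. $M\subseteq\mathcal{M}_\#^d(M)$. -/

import Mathlib

namespace BisimMetric

/-! ### Functions with values in `[0,1]`, suprema and infima

The unit interval carries its complete-lattice structure; in particular the supremum of the empty
family is `0` and the infimum of the empty family is `1`. -/

/-- Truncated subtraction `x ⊖ y = max {0, x - y}` on `[0,1]`. -/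
def tsub (x y : unitInterval) : unitInterval :=
  ⟨max 0 ((x : ℝ) - y), le_max_left _ _,
    max_le zero_le_one (by have h1 := x.2.2; have h2 := y.2.1; linarith)⟩

/-- The norm `‖a‖ = max {a y | y}`. -/
noncomputable def norm {Y : Type*} (a : Y → unitInterval) : unitInterval := ⨆ y, a y

/-- Non-expansiveness: `‖f b ⊖ f a‖ ≤ ‖b ⊖ a‖` for all `a`, `b`. -/
def NonExpansive {Y Z : Type*} (f : (Y → unitInterval) → (Z → unitInterval)) : Prop :=
  ∀ a b : Y → unitInterval,
    norm (fun z => tsub (f b z) (f a z)) ≤ norm (fun y => tsub (b y) (a y))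

/-! ### The approximation of a function in the dual sense -/

/-- `[Y]^a`: the points where `a` is not `0`, so that there is potential to decrease. -/
def topSet {Y : Type*} (a : Y → unitInterval) : Set Y := {y | a y ≠ 0}

/-- `δ^a = min {a y | y ∈ [Y]^a}` (equal to `1` if `[Y]^a` is empty). -/
noncomputable def minTop {Y : Type*} (a : Y → unitInterval) : unitInterval :=
  sInf (a '' topSet a)

open Classical in
/-- `a ⊖ θ_{Y'}`: decrease `a` by `θ` on `Y'`. -/
noncomputable def decrease {Y : Type*} (a : Y → unitInterval) (θ : unitInterval) (Y' : Set Y) :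
    Y → unitInterval :=
  fun y => tsub (a y) (if y ∈ Y' then θ else 0)

/-- `f_#^{a,θ}(Y')`: the points of `[Z]^{f a}` to which `f` propagates a decrease of `a` by `θ`
on `Y' ⊆ [Y]^a`. -/
def dualApproxAt {Y Z : Type*} (f : (Y → unitInterval) → (Z → unitInterval))
    (a : Y → unitInterval) (θ : unitInterval) (Y' : Set Y) : Set Z :=
  {z | z ∈ topSet (f a) ∧ θ ≤ tsub (f a z) (f (decrease a θ Y') z)}

/-- The largest `θ` such that `z ∈ f_#^{a,θ}(Y')`. -/
noncomputable def iotaAt {Y Z : Type*} (f : (Y → unitInterval) → (Z → unitInterval))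
    (a : Y → unitInterval) (Y' : Set Y) (z : Z) : unitInterval :=
  sSup {θ | z ∈ dualApproxAt f a θ Y'}

/-- The minimum of `δ^a` and of all nonzero values `iotaAt f a Y' z` with `Y' ⊆ [Y]^a` and
`z ∈ [Z]^{f a}`. -/
noncomputable def iota {Y Z : Type*} (f : (Y → unitInterval) → (Z → unitInterval))
    (a : Y → unitInterval) : unitInterval :=
  sInf ({θ | ∃ Y' ⊆ topSet a, ∃ z ∈ topSet (f a), iotaAt f a Y' z = θ ∧ θ ≠ 0} ∪ {minTop a})

/-- The approximation `f_#^a`, to be applied to subsets of `[Y]^a`, with values the subsets of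
`[Z]^{f a}`. -/
noncomputable def dualApprox {Y Z : Type*} (f : (Y → unitInterval) → (Z → unitInterval))
    (a : Y → unitInterval) (Y' : Set Y) : Set Z :=
  dualApproxAt f a (iota f a) Y'

/-! ### Basic functions -/

/-- Constant function `c_k`. -/
def const {Y Z : Type*} (k : Z → unitInterval) : (Y → unitInterval) → (Z → unitInterval) :=
  fun _ => k

/-- Reindexing `u^*(a) = a ∘ u`. -/
def reindex {Y Z : Type*} (u : Z → Y) : (Y → unitInterval) → (Z → unitInterval) :=
  fun a => a ∘ u

/-- `max_R(a)(z) = max {a y | y R z}`; a map `u` is used as the relation `u y = z`. -/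
noncomputable def maxRel {Y Z : Type*} (R : Y → Z → Prop) :
    (Y → unitInterval) → (Z → unitInterval) :=
  fun a z => ⨆ y, ⨆ (_ : R y z), a y

/-- Disjoint union `f ⊎ g` of two functions with the same index set on the argument side. -/
def disjUnion {Y Z₁ Z₂ : Type*} (f : (Y → unitInterval) → (Z₁ → unitInterval))
    (g : (Y → unitInterval) → (Z₂ → unitInterval)) :
    (Y → unitInterval) → (Z₁ ⊕ Z₂ → unitInterval) :=
  fun a => Sum.elim (f a) (g a)

/-! ### Hausdorff and Kantorovich liftings -/

/-- The Hausdorff lifting. -/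
noncomputable def hausdorff {X : Type*} (d : X × X → unitInterval) :
    Set X × Set X → unitInterval :=
  fun P => max (⨆ x₁ ∈ P.1, ⨅ x₂ ∈ P.2, d (x₁, x₂)) (⨆ x₂ ∈ P.2, ⨅ x₁ ∈ P.1, d (x₁, x₂))

/-- Probability distributions on a finite set. -/
abbrev Dist (X : Type*) [Fintype X] : Type _ := stdSimplex ℝ X

/-- Couplings of `p` and `q`: the distributions on `X × X` with marginals `p` and `q`. -/
def couplings {X : Type*} [Fintype X] (p q : Dist X) : Set (Dist (X × X)) :=
  {c | (∀ x₁, p.1 x₁ = ∑ x₂, c.1 (x₁, x₂)) ∧ (∀ x₂, q.1 x₂ = ∑ x₁, c.1 (x₁, x₂))}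

/-- The support of a distribution. -/
def supp {X : Type*} [Fintype X] (p : Dist X) : Set X := {x | 0 < p.1 x}

/-- The average `∑ y, p y * a y` of `a` with respect to `p`. -/
noncomputable def average {Y : Type*} [Fintype Y] (p : Dist Y) (a : Y → unitInterval) :
    unitInterval :=
  ⟨∑ y, p.1 y * (a y : ℝ),
    Finset.sum_nonneg fun y _ => mul_nonneg (p.2.1 y) (a y).2.1,
    (Finset.sum_le_sum fun y _ => mul_le_of_le_one_right (p.2.1 y) (a y).2.2).trans p.2.2.le⟩

/-- The Kantorovich lifting, over a finite set `D` of distributions on `X`. -/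
noncomputable def kantorovich {X : Type*} [Fintype X] (D : Finset (Dist X))
    (d : X × X → unitInterval) : D × D → unitInterval :=
  fun P => ⨅ c ∈ couplings P.1.1 P.2.1, average c d

/-! ### Probabilistic automata -/

/-- A probabilistic automaton with states `S` and labels `L`, whose distributions are taken from a
finite set `D` of distributions on `S`. -/
structure ProbAutomaton (S L : Type*) [Fintype S] where
  /-- the finite set of distributions in use -/
  D : Finset (Dist S)
  /-- the (possibly empty) set of successor distributions of a state -/
  η : S → Set D
  /-- the labelling -/
  label : S → L

namespace ProbAutomaton

variable {S L : Type*} [Fintype S]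

open Classical in
/-- The function `ℳ` whose least fixpoint is the probabilistic bisimilarity pseudo-metric. -/
noncomputable def bisimFun (A : ProbAutomaton S L) (d : S × S → unitInterval) :
    S × S → unitInterval :=
  fun P =>
    if A.label P.1 ≠ A.label P.2 then 1
    else hausdorff (kantorovich A.D d) (A.η P.1, A.η P.2)

open Classical in
/-- `l(s,t)` is `0` if `s` and `t` have the same label and `1` otherwise. -/
noncomputable def labelDist (A : ProbAutomaton S L) : S × S → unitInterval :=
  fun P => if A.label P.1 = A.label P.2 then 0 else 1

/-- Self-closed relations with respect to `d`. -/
def SelfClosed (A : ProbAutomaton S L) (d : S × S → unitInterval) (M : Set (S × S)) : Prop :=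
  ∀ s t : S, (s, t) ∈ M →
    (A.label s = A.label t ∧ 0 < d (s, t)) ∧
    (∀ p ∈ A.η s, d (s, t) = ⨅ q' ∈ A.η t, kantorovich A.D d (p, q') →
      ∃ q ∈ A.η t, ∃ c ∈ couplings p.1 q.1, d (s, t) = average c d ∧ supp c ⊆ M) ∧
    (∀ q ∈ A.η t, d (s, t) = ⨅ p' ∈ A.η s, kantorovich A.D d (p', q) →
      ∃ p ∈ A.η s, ∃ c ∈ couplings p.1 q.1, d (s, t) = average c d ∧ supp c ⊆ M)

end ProbAutomaton

end BisimMetric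

namespace BisimMetric

/-! ### Truncated subtraction -/

/-! The number `iota` is awkward to compute, but non-expansiveness makes its exact value irrelevant:
a point to which a decrease by some positive `θ` on `M` propagates already lies in `dualApprox`
(`NonExpansive.mem_dualApprox`). Since `iota` is itself positive, membership means propagation for
one conveniently chosen `θ > 0`.

For `θ ≤ d` on `M`, a coupling `c` averages the decreased function to `average c d - θ * c(M)`. Let
`v = d (s, t)`. As `d` is a fixpoint, `v` bounds every one-sided minimum of the Hausdorff lifting,
and propagation says that each of these minima drops to at most `v - θ`. A minimum equal to `v` can
do so only through an optimal coupling with `c(M) = 1`, that is, one supported in `M`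
(`exists_coupling_supp_subset`). Conversely such a coupling produces the drop, while a minimum
strictly below `v` is already at distance `θ` once `θ` is small, there being finitely many gaps
(`iInf_kantorovich_decrease_add_le`).

Non-expansiveness of the automaton function follows because infima, suprema, maxima and averages all
preserve a bound on the truncated difference. -/

theorem tsub_le_iff {x y θ : unitInterval} : tsub x y ≤ θ ↔ (x : ℝ) ≤ y + θ := by
  have h := θ.2.1
  rw [← Subtype.coe_le_coe]
  change max 0 ((x : ℝ) - y) ≤ θ ↔ _
  rw [max_le_iff]
  constructor
  · rintro ⟨_, h2⟩
    linarith
  · intro h2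
    exact ⟨h, by linarith⟩

theorem tsub_le_comm {x y θ : unitInterval} : tsub x y ≤ θ ↔ tsub x θ ≤ y := by
  rw [tsub_le_iff, tsub_le_iff, add_comm]

theorem le_tsub_iff {x y θ : unitInterval} (h : 0 < θ) :
    θ ≤ tsub x y ↔ (y : ℝ) + θ ≤ x := by
  have h' : (0 : ℝ) < θ := h
  rw [← Subtype.coe_le_coe]
  change (θ : ℝ) ≤ max 0 ((x : ℝ) - y) ↔ _
  rw [le_max_iff]
  constructor
  · rintro (h2 | h2) <;> linarith
  · intro h2
    exact Or.inr (by linarith)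

theorem coe_tsub_of_le {x y : unitInterval} (h : y ≤ x) : (tsub x y : ℝ) = x - y := by
  have h' : (y : ℝ) ≤ x := h
  change max 0 ((x : ℝ) - y) = _
  exact max_eq_right (by linarith)

theorem tsub_mono_left {x x' y : unitInterval} (h : x ≤ x') : tsub x y ≤ tsub x' y := by
  have h' : (x : ℝ) ≤ x' := h
  exact Subtype.coe_le_coe.mp (max_le_max le_rfl (by linarith))

theorem tsub_anti_right {x y y' : unitInterval} (h : y ≤ y') : tsub x y' ≤ tsub x y := by
  have h' : (y : ℝ) ≤ y' := h
  exact Subtype.coe_le_coe.mp (max_le_max le_rfl (by linarith))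

theorem tsub_le_zero_iff {x y : unitInterval} : tsub x y ≤ 0 ↔ x ≤ y := by
  rw [tsub_le_iff, ← Subtype.coe_le_coe]
  simp

theorem tsub_iInf_le {ι : Sort*} {f g : ι → unitInterval} {θ : unitInterval}
    (h : ∀ i, tsub (f i) (g i) ≤ θ) : tsub (⨅ i, f i) (⨅ i, g i) ≤ θ := by
  rw [tsub_le_comm]
  exact le_iInf fun i => (tsub_mono_left (iInf_le f i)).trans (tsub_le_comm.mp (h i))

theorem tsub_iSup_le {ι : Sort*} {f g : ι → unitInterval} {θ : unitInterval}
    (h : ∀ i, tsub (f i) (g i) ≤ θ) : tsub (⨆ i, f i) (⨆ i, g i) ≤ θ := by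
  have h0 : (0 : ℝ) ≤ (⨆ i, g i : unitInterval) + θ := add_nonneg (⨆ i, g i : unitInterval).2.1 θ.2.1
  -- The bound `sup g + θ` may exceed `1`, so it is cut off at `1` to stay in the lattice.
  have key : (⨆ i, f i) ≤
      (⟨min 1 ((⨆ i, g i : unitInterval) + θ), le_min zero_le_one h0, min_le_left _ _⟩ :
        unitInterval) := by
    refine iSup_le fun i => Subtype.coe_le_coe.mp (le_min (f i).2.2 ?_)
    have h1 := tsub_le_iff.mp (h i)
    have h2 : (g i : ℝ) ≤ (⨆ i, g i : unitInterval) := le_iSup g i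
    linarith
  exact tsub_le_iff.mpr ((Subtype.coe_le_coe.mpr key).trans (min_le_right _ _))

theorem tsub_max_le {x x' y y' θ : unitInterval} (h : tsub x y ≤ θ) (h' : tsub x' y' ≤ θ) :
    tsub (max x x') (max y y') ≤ θ := by
  rcases le_total x x' with hx | hx
  · rw [max_eq_right hx]
    exact (tsub_anti_right (le_max_right _ _)).trans h'
  · rw [max_eq_left hx]
    exact (tsub_anti_right (le_max_left _ _)).trans h

/-! ### Non-expansive functions and their approximations -/

theorem NonExpansive.tsub_le {Y Z : Type*} {f : (Y → unitInterval) → (Z → unitInterval)}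
    (hf : NonExpansive f) {a b : Y → unitInterval} {θ : unitInterval}
    (h : ∀ y, tsub (b y) (a y) ≤ θ) (z : Z) : tsub (f b z) (f a z) ≤ θ :=
  (le_iSup (fun z => tsub (f b z) (f a z)) z).trans ((hf a b).trans (iSup_le h))

theorem nonExpansive_of_tsub_le {Y Z : Type*} {f : (Y → unitInterval) → (Z → unitInterval)}
    (h : ∀ a b θ, (∀ y, tsub (b y) (a y) ≤ θ) → ∀ z, tsub (f b z) (f a z) ≤ θ) :
    NonExpansive f := fun a b =>
  iSup_le (h a b _ fun y => le_iSup (fun y => tsub (b y) (a y)) y)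

theorem NonExpansive.mono {Y Z : Type*} {f : (Y → unitInterval) → (Z → unitInterval)}
    (hf : NonExpansive f) {a b : Y → unitInterval} (h : ∀ y, b y ≤ a y) (z : Z) :
    f b z ≤ f a z :=
  tsub_le_zero_iff.mp (hf.tsub_le (fun y => tsub_le_zero_iff.mpr (h y)) z)

theorem decrease_of_mem {Y : Type*} {a : Y → unitInterval} {θ : unitInterval} {M : Set Y} {y : Y}
    (h : y ∈ M) : decrease a θ M y = tsub (a y) θ := by
  simp [decrease, h]

theorem decrease_of_notMem {Y : Type*} {a : Y → unitInterval} {θ : unitInterval} {M : Set Y}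
    {y : Y} (h : y ∉ M) : decrease a θ M y = a y := by
  refine Subtype.ext ?_
  simp only [decrease, h, if_false]
  rw [coe_tsub_of_le (a y).2.1]
  simp

theorem decrease_anti {Y : Type*} (a : Y → unitInterval) {θ θ' : unitInterval} (h : θ ≤ θ')
    (M : Set Y) (y : Y) : decrease a θ' M y ≤ decrease a θ M y := by
  by_cases hy : y ∈ M
  · rw [decrease_of_mem hy, decrease_of_mem hy]
    exact tsub_anti_right h
  · rw [decrease_of_notMem hy, decrease_of_notMem hy]

theorem decrease_le {Y : Type*} (a : Y → unitInterval) (θ : unitInterval)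
    (M : Set Y) (y : Y) : decrease a θ M y ≤ a y := by
  by_cases hy : y ∈ M
  · rw [decrease_of_mem hy, tsub_le_iff]
    linarith [θ.2.1]
  · rw [decrease_of_notMem hy]

theorem tsub_decrease_le {Y : Type*} (a : Y → unitInterval) {θ θ' : unitInterval} (h : θ ≤ θ')
    (M : Set Y) (y : Y) : tsub (decrease a θ M y) (decrease a θ' M y) ≤ tsub θ' θ := by
  rw [tsub_le_iff, coe_tsub_of_le h]
  have h' : (θ : ℝ) ≤ θ' := h
  by_cases hy : y ∈ M
  · rw [decrease_of_mem hy, decrease_of_mem hy]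
    have h1 := tsub_le_iff.mp (le_refl (tsub (a y) θ'))
    refine max_le ?_ (by linarith)
    linarith [(tsub (a y) θ').2.1]
  · rw [decrease_of_notMem hy, decrease_of_notMem hy]
    linarith

/-- Adding `1` to the nonzero elements makes the set nonempty, so its infimum is attained and hence
nonzero. -/
theorem exists_pos_lowerBound {T : Set unitInterval} (hT : T.Finite) :
    ∃ θ : unitInterval, 0 < θ ∧ ∀ x ∈ T, x ≠ 0 → θ ≤ x := by
  refine ⟨sInf (insert 1 (T \ {0})), ?_, fun x hx h0 => sInf_le (Or.inr ⟨hx, h0⟩)⟩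
  have := (Set.insert_nonempty 1 (T \ {0})).csInf_mem ((hT.subset Set.sdiff_subset).insert 1)
  rcases this with h | h
  · rw [h]
    exact zero_lt_one
  · exact lt_of_le_of_ne (sInf _ : unitInterval).2.1 (Ne.symm h.2)

theorem minTop_pos {Y : Type*} [Finite Y] (a : Y → unitInterval) : 0 < minTop a := by
  obtain ⟨θ, hθ, h⟩ := exists_pos_lowerBound (Set.finite_range a)
  refine hθ.trans_le (le_sInf ?_)
  rintro _ ⟨y, hy, rfl⟩
  exact h _ ⟨y, rfl⟩ hy

theorem minTop_le {Y : Type*} {a : Y → unitInterval} {y : Y} (h : y ∈ topSet a) :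
    minTop a ≤ a y :=
  sInf_le ⟨y, h, rfl⟩

theorem iota_le_minTop {Y Z : Type*} (f : (Y → unitInterval) → (Z → unitInterval))
    (a : Y → unitInterval) : iota f a ≤ minTop a :=
  sInf_le (Or.inr rfl)

/-- Finitely many pairs `(Y', z)` give finitely many values, and zero is excluded among them. -/
theorem iota_pos {Y Z : Type*} [Finite Y] [Finite Z]
    (f : (Y → unitInterval) → (Z → unitInterval)) (a : Y → unitInterval) : 0 < iota f a := by
  obtain ⟨θ, hθ, h⟩ := exists_pos_lowerBound
    ((Set.finite_range fun x : Set Y × Z => iotaAt f a x.1 x.2).insert (minTop a))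
  refine hθ.trans_le (le_sInf ?_)
  rintro x (⟨Y', _, z, _, rfl, h0⟩ | rfl)
  · exact h _ (Or.inr ⟨(Y', z), rfl⟩) h0
  · exact h _ (Or.inl rfl) (minTop_pos a).ne'

/-- The supremum is attained and the admissible `θ` are closed downwards. If the drop at `θ` were
below `θ`, some admissible `θ'` would exceed that drop. For `θ' ≤ θ` this contradicts monotonicity;
for `θ ≤ θ'`, passing from `θ` to `θ'` adds at most `θ' - θ` to the drop, so the drop at `θ` is at
least `θ` after all. -/
theorem NonExpansive.mem_dualApproxAt_of_le_iotaAt {Y Z : Type*}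
    {f : (Y → unitInterval) → (Z → unitInterval)} (hf : NonExpansive f) {a : Y → unitInterval}
    {M : Set Y} {z : Z} (hz : z ∈ topSet (f a)) {θ : unitInterval} (h : θ ≤ iotaAt f a M z) :
    z ∈ dualApproxAt f a θ M := by
  refine ⟨hz, ?_⟩
  by_contra! hlt
  obtain ⟨θ', ⟨_, h1⟩, h2⟩ := lt_sSup_iff.mp (hlt.trans_le h)
  rcases le_total θ' θ with hle | hle
  · exact (h2.trans_le (h1.trans (tsub_anti_right (hf.mono (decrease_anti a hle M) z)))).false
  · have hpos : 0 < θ := lt_of_le_of_lt unitInterval.nonneg' hlt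
    rw [le_tsub_iff (hpos.trans_le hle)] at h1
    have h3 := tsub_le_iff.mp (hf.tsub_le (tsub_decrease_le a hle M) z)
    rw [coe_tsub_of_le hle] at h3
    exact hlt.not_ge ((le_tsub_iff hpos).mpr (by linarith))

/-- A positive admissible `θ` makes `iotaAt f a M z` nonzero, so it takes part in the minimum
defining `iota` and `iota f a ≤ iotaAt f a M z`. -/
theorem NonExpansive.mem_dualApprox {Y Z : Type*}
    {f : (Y → unitInterval) → (Z → unitInterval)} (hf : NonExpansive f) {a : Y → unitInterval}
    {M : Set Y} (hM : M ⊆ topSet a) {z : Z} {θ : unitInterval} (hθ : 0 < θ)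
    (h : z ∈ dualApproxAt f a θ M) : z ∈ dualApprox f a M := by
  have hle : θ ≤ iotaAt f a M z := le_sSup h
  exact hf.mem_dualApproxAt_of_le_iotaAt h.1
    (sInf_le (Or.inl ⟨M, hM, z, h.1, rfl, (hθ.trans_le hle).ne'⟩))

/-! ### The liftings -/

theorem tsub_hausdorff_le {X : Type*} {a b : X × X → unitInterval} {θ : unitInterval}
    (h : ∀ x, tsub (b x) (a x) ≤ θ) (P : Set X × Set X) :
    tsub (hausdorff b P) (hausdorff a P) ≤ θ :=
  tsub_max_le
    (tsub_iSup_le fun _ => tsub_iSup_le fun _ => tsub_iInf_le fun _ => tsub_iInf_le fun _ => h _)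
    (tsub_iSup_le fun _ => tsub_iSup_le fun _ => tsub_iInf_le fun _ => tsub_iInf_le fun _ => h _)

theorem tsub_average_le {Y : Type*} [Fintype Y] (p : Dist Y) {a b : Y → unitInterval}
    {θ : unitInterval} (h : ∀ y, tsub (b y) (a y) ≤ θ) :
    tsub (average p b) (average p a) ≤ θ := by
  rw [tsub_le_iff]
  change ∑ y, p.1 y * (b y : ℝ) ≤ ∑ y, p.1 y * (a y : ℝ) + θ
  calc ∑ y, p.1 y * (b y : ℝ) ≤ ∑ y, p.1 y * ((a y : ℝ) + θ) :=
        Finset.sum_le_sum fun y _ => mul_le_mul_of_nonneg_left (tsub_le_iff.mp (h y)) (p.2.1 y)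
    _ = ∑ y, p.1 y * (a y : ℝ) + θ := by
        simp_rw [mul_add]
        rw [Finset.sum_add_distrib, ← Finset.sum_mul, p.2.2, one_mul]

theorem tsub_kantorovich_le {X : Type*} [Fintype X] (D : Finset (Dist X))
    {a b : X × X → unitInterval} {θ : unitInterval} (h : ∀ x, tsub (b x) (a x) ≤ θ) (P : D × D) :
    tsub (kantorovich D b P) (kantorovich D a P) ≤ θ :=
  tsub_iInf_le fun c => tsub_iInf_le fun _ => tsub_average_le c h

theorem kantorovich_mono {X : Type*} [Fintype X] (D : Finset (Dist X))
    {a b : X × X → unitInterval} (h : ∀ x, b x ≤ a x) (P : D × D) :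
    kantorovich D b P ≤ kantorovich D a P :=
  tsub_le_zero_iff.mp (tsub_kantorovich_le D (fun x => tsub_le_zero_iff.mpr (h x)) P)

theorem isCompact_couplings {X : Type*} [Fintype X] (p q : Dist X) :
    IsCompact (couplings p q) := by
  refine IsClosed.isCompact ?_
  have hc : ∀ x : X × X, Continuous fun c : Dist (X × X) => c.1 x := fun x =>
    (continuous_apply x).comp continuous_subtype_val
  refine IsClosed.and ?_ ?_ <;> simp only [Set.ofPred_forall] <;>
    exact isClosed_iInter fun x =>
      isClosed_eq continuous_const (continuous_finsetSum _ fun y _ => hc _)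

theorem continuous_average {Y : Type*} [Fintype Y] (a : Y → unitInterval) :
    Continuous fun p : Dist Y => average p a := by
  refine Continuous.subtype_mk (continuous_finsetSum _ fun y _ => Continuous.mul ?_ ?_) _
  · exact (continuous_apply y).comp continuous_subtype_val
  · exact continuous_const

/-- A continuous function attains its minimum on the compact set of couplings. Nonemptiness comes
from the hypothesis, since an empty infimum would be `1`. -/
theorem exists_average_eq_kantorovich {X : Type*} [Fintype X] {D : Finset (Dist X)}
    {d : X × X → unitInterval} {P : D × D} (h : kantorovich D d P < 1) :
    ∃ c ∈ couplings P.1.1 P.2.1, average c d = kantorovich D d P := by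
  have hne : (couplings P.1.1 P.2.1).Nonempty := by
    by_contra hne
    rw [Set.not_nonempty_iff_eq_empty] at hne
    refine h.ne (le_antisymm unitInterval.le_one' ?_)
    simp only [kantorovich, hne, Set.mem_empty_iff_false, iInf_false, iInf_top]
    exact le_top
  obtain ⟨c, hc, hmin⟩ := (isCompact_couplings P.1.1 P.2.1).exists_isMinOn hne
    (continuous_average d).continuousOn
  exact ⟨c, hc, le_antisymm (le_iInf₂ fun c' hc' => hmin hc') (iInf₂_le c hc)⟩

-- The bound `θ ≤ a y` on `M` means that no subtraction is truncated, so the average falls by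
-- exactly `θ` times the mass of `M`.
open Classical in
theorem average_decrease {Y : Type*} [Fintype Y] (p : Dist Y) {a : Y → unitInterval}
    {θ : unitInterval} {M : Set Y} (h : ∀ y ∈ M, θ ≤ a y) :
    (average p (decrease a θ M) : ℝ) = average p a - θ * ∑ y, if y ∈ M then p.1 y else 0 := by
  change ∑ y, p.1 y * (decrease a θ M y : ℝ) = ∑ y, p.1 y * (a y : ℝ) - _
  rw [Finset.mul_sum, ← Finset.sum_sub_distrib]
  refine Finset.sum_congr rfl fun y _ => ?_
  by_cases hy : y ∈ M
  · rw [decrease_of_mem hy, coe_tsub_of_le (h y hy), if_pos hy]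
    ring
  · rw [decrease_of_notMem hy, if_neg hy]
    ring

open Classical in
theorem supp_subset_iff {Y : Type*} [Fintype Y] (p : Dist Y) (M : Set Y) :
    supp p ⊆ M ↔ 1 ≤ ∑ y, if y ∈ M then p.1 y else 0 := by
  have hle : ∀ y, (if y ∈ M then p.1 y else 0) ≤ p.1 y := fun y => by
    split_ifs
    · exact le_rfl
    · exact p.2.1 y
  constructor
  · intro h
    rw [← p.2.2]
    refine Finset.sum_le_sum fun y _ => ?_
    split_ifs with hy
    · exact le_rfl
    · exact not_lt.mp fun hlt => hy (h hlt)
  · intro h y hy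
    by_contra hyM
    rw [← p.2.2] at h
    refine h.not_gt (Finset.sum_lt_sum (fun y _ => hle y) ⟨y, Finset.mem_univ y, ?_⟩)
    rw [if_neg hyM]
    exact hy

/-- If decreasing `d` by `θ` on `M` decreases the distance by `θ`, then this is witnessed by
an optimal coupling supported on `M`. -/
theorem exists_coupling_supp_subset {X κ : Type*} [Fintype X] {D : Finset (Dist X)}
    {d : X × X → unitInterval} {M : Set (X × X)} {θ v : unitInterval} (hθ : 0 < θ)
    (hM : ∀ x ∈ M, θ ≤ d x) {T : Set κ} [Finite κ] {k : κ → D × D}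
    (hv : v = ⨅ j ∈ T, kantorovich D d (k j))
    (h : ((⨅ j ∈ T, kantorovich D (decrease d θ M) (k j) : unitInterval) : ℝ) + θ ≤ v) :
    ∃ j ∈ T, ∃ c ∈ couplings (k j).1.1 (k j).2.1, v = average c d ∧ supp c ⊆ M := by
  have hθ' : (0 : ℝ) < θ := hθ
  have hv1 := v.2.2
  -- Being at least `θ > 0` below `v ≤ 1`, the infimum avoids the default value `1`; hence neither
  -- `T` nor the relevant set of couplings is empty.
  have hlt : (⨅ j ∈ T, kantorovich D (decrease d θ M) (k j)) < 1 := by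
    rw [← Subtype.coe_lt_coe]
    change _ < (1 : ℝ)
    linarith
  have hne : T.Nonempty := by
    by_contra hne
    rw [Set.not_nonempty_iff_eq_empty] at hne
    refine hlt.not_ge ?_
    simp only [hne, Set.mem_empty_iff_false, iInf_false, iInf_top]
    exact le_top
  obtain ⟨j, hj, hmin⟩ := Set.exists_min_image T
    (fun j => kantorovich D (decrease d θ M) (k j)) T.toFinite hne
  have hjeq : (⨅ j ∈ T, kantorovich D (decrease d θ M) (k j)) =
      kantorovich D (decrease d θ M) (k j) :=
    le_antisymm (iInf₂_le j hj) (le_iInf₂ hmin)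
  rw [hjeq] at h hlt
  obtain ⟨c, hc, hceq⟩ := exists_average_eq_kantorovich hlt
  have hvc : v ≤ average c d := by
    rw [hv]
    exact (iInf₂_le j hj).trans (iInf₂_le c hc)
  have hvc' : (v : ℝ) ≤ average c d := hvc
  classical
  have havg := average_decrease c hM
  rw [← hceq, havg] at h
  -- With `m` the mass of `M`, `average c d - θ * m + θ ≤ v ≤ average c d` forces `θ * (1 - m) ≤ 0`.
  have hge : 1 ≤ ∑ y, if y ∈ M then c.1 y else 0 := by
    by_contra! hlt'
    nlinarith
  have hle : (∑ y, if y ∈ M then c.1 y else 0) ≤ 1 := by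
    rw [← c.2.2]
    refine Finset.sum_le_sum fun y _ => ?_
    split_ifs
    · exact le_rfl
    · exact c.2.1 y
  refine ⟨j, hj, c, hc, le_antisymm hvc (Subtype.coe_le_coe.mp ?_), (supp_subset_iff c M).mpr hge⟩
  rw [le_antisymm hle hge] at h
  linarith

/-- Converse of `exists_coupling_supp_subset`. If the infimum equals `v`, the given coupling has all
its mass on `M` and its average falls by `θ`. Otherwise the gap below `v` is nonzero, hence at least
`θ`, and decreasing `d` cannot shrink it. -/
theorem iInf_kantorovich_decrease_add_le {X κ : Type*} [Fintype X] {D : Finset (Dist X)}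
    {d : X × X → unitInterval} {M : Set (X × X)} {θ v : unitInterval} (hM : ∀ x ∈ M, θ ≤ d x)
    {T : Set κ} {k : κ → D × D} (hv : (⨅ j ∈ T, kantorovich D d (k j)) ≤ v)
    (hθv : tsub v (⨅ j ∈ T, kantorovich D d (k j)) ≠ 0 →
      θ ≤ tsub v (⨅ j ∈ T, kantorovich D d (k j)))
    (h : v = (⨅ j ∈ T, kantorovich D d (k j)) →
      ∃ j ∈ T, ∃ c ∈ couplings (k j).1.1 (k j).2.1, v = average c d ∧ supp c ⊆ M) :
    ((⨅ j ∈ T, kantorovich D (decrease d θ M) (k j) : unitInterval) : ℝ) + θ ≤ v := by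
  by_cases h0 : tsub v (⨅ j ∈ T, kantorovich D d (k j)) = 0
  · obtain ⟨j, hj, c, hc, hvc, hsupp⟩ := h (le_antisymm (tsub_le_zero_iff.mp h0.le) hv)
    have h1 : ((⨅ j ∈ T, kantorovich D (decrease d θ M) (k j) : unitInterval) : ℝ) ≤
        average c (decrease d θ M) := Subtype.coe_le_coe.mpr
      ((iInf₂_le j hj).trans (iInf₂_le c hc))
    classical
    rw [average_decrease c hM, ← hvc] at h1
    nlinarith [(supp_subset_iff c M).mp hsupp, θ.2.1]
  · have h1 : (θ : ℝ) ≤ _ := hθv h0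
    rw [coe_tsub_of_le hv] at h1
    have h2 : ((⨅ j ∈ T, kantorovich D (decrease d θ M) (k j) : unitInterval) : ℝ) ≤
        (⨅ j ∈ T, kantorovich D d (k j) : unitInterval) := Subtype.coe_le_coe.mpr
      (iInf₂_mono fun j _ => kantorovich_mono D (decrease_le d θ M) (k j))
    linarith

/-- When `θ ≤ v` the inequality reads `hausdorff e P ≤ tsub v θ`, which splits over maximum and
suprema; this covers empty sets too. -/
theorem hausdorff_add_le_iff {X : Type*} {e : X × X → unitInterval} {P : Set X × Set X}
    {θ v : unitInterval} (hθ : θ ≤ v) :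
    (hausdorff e P : ℝ) + θ ≤ v ↔
      (∀ x ∈ P.1, ((⨅ y ∈ P.2, e (x, y) : unitInterval) : ℝ) + θ ≤ v) ∧
      ∀ y ∈ P.2, ((⨅ x ∈ P.1, e (x, y) : unitInterval) : ℝ) + θ ≤ v := by
  have key : ∀ x : unitInterval, (x : ℝ) + θ ≤ v ↔ x ≤ tsub v θ := fun x => by
    rw [← Subtype.coe_le_coe, coe_tsub_of_le hθ, le_sub_iff_add_le]
  simp only [key, hausdorff, max_le_iff, iSup_le_iff]

/-! ### Probabilistic automata -/

namespace ProbAutomaton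

theorem bisimFun_of_label_eq {S L : Type*} [Fintype S] (A : ProbAutomaton S L)
    (d : S × S → unitInterval) {s t : S} (h : A.label s = A.label t) :
    A.bisimFun d (s, t) = hausdorff (kantorovich A.D d) (A.η s, A.η t) := by
  simp [bisimFun, h]

theorem bisimFun_of_label_ne {S L : Type*} [Fintype S] (A : ProbAutomaton S L)
    (d : S × S → unitInterval) {s t : S} (h : A.label s ≠ A.label t) :
    A.bisimFun d (s, t) = 1 := by
  simp [bisimFun, h]

theorem bisimFun_eq_maxRel {S L : Type*} [Fintype S] (A : ProbAutomaton S L) :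
    A.bisimFun =
      maxRel (fun (y : (S × S) ⊕ (S × S)) (z : S × S) => Sum.elim id id y = z) ∘
        disjUnion (reindex (Prod.map A.η A.η) ∘ hausdorff ∘ kantorovich A.D)
          (const A.labelDist) := by
  funext d ⟨s, t⟩
  simp only [Function.comp_apply, maxRel, disjUnion, iSup_sum, Sum.elim_inl, Sum.elim_inr, id_eq,
    iSup_iSup_eq_left, reindex, const, Prod.map_apply]
  by_cases h : A.label s = A.label t
  · rw [A.bisimFun_of_label_eq d h]
    simp only [labelDist, h, if_true]
    exact (sup_eq_left.mpr unitInterval.nonneg').symm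
  · rw [A.bisimFun_of_label_ne d h]
    simp only [labelDist, h, if_false]
    exact (sup_eq_right.mpr unitInterval.le_one').symm

theorem nonExpansive_bisimFun {S L : Type*} [Fintype S] (A : ProbAutomaton S L) :
    NonExpansive A.bisimFun := by
  refine nonExpansive_of_tsub_le fun a b θ h => ?_
  rintro ⟨s, t⟩
  by_cases hl : A.label s = A.label t
  · rw [A.bisimFun_of_label_eq a hl, A.bisimFun_of_label_eq b hl]
    exact tsub_hausdorff_le (tsub_kantorovich_le A.D h) _
  · rw [A.bisimFun_of_label_ne a hl, A.bisimFun_of_label_ne b hl]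
    exact (tsub_le_zero_iff.mpr le_rfl).trans θ.2.1

theorem selfClosed_of_subset_dualApprox {S L : Type*} [Fintype S] (A : ProbAutomaton S L)
    {d : S × S → unitInterval} (hd : d = A.bisimFun d) {M : Set (S × S)} (hM : M ⊆ topSet d)
    (h : M ⊆ dualApprox A.bisimFun d M) : A.SelfClosed d M := by
  intro s t hst
  have hpos := iota_pos A.bisimFun d
  have hle : ∀ x ∈ M, iota A.bisimFun d ≤ d x := fun x hx =>
    (iota_le_minTop _ d).trans (minTop_le (hM hx))
  have hι := (h hst).2
  rw [le_tsub_iff hpos, ← hd] at hι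
  -- For different labels the value is constantly `1` and cannot drop.
  have hl : A.label s = A.label t := by
    by_contra hl
    rw [A.bisimFun_of_label_ne _ hl] at hι
    have h1 : (0 : ℝ) < iota A.bisimFun d := hpos
    have h2 := (d (s, t)).2.2
    exact absurd hι (not_le.mpr (by rw [Set.Icc.coe_one]; linarith))
  rw [A.bisimFun_of_label_eq _ hl, hausdorff_add_le_iff (hle _ hst)] at hι
  refine ⟨⟨hl, hpos.trans_le (hle _ hst)⟩, fun p hp heq => ?_, fun q hq heq => ?_⟩
  · exact exists_coupling_supp_subset (k := fun q => (p, q)) hpos hle heq (hι.1 p hp)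
  · exact exists_coupling_supp_subset (k := fun p => (p, q)) hpos hle heq (hι.2 q hq)

theorem SelfClosed.subset_topSet {S L : Type*} [Fintype S] {A : ProbAutomaton S L}
    {d : S × S → unitInterval} {M : Set (S × S)} (h : A.SelfClosed d M) : M ⊆ topSet d :=
  fun x hx => (h x.1 x.2 hx).1.2.ne'

theorem SelfClosed.subset_dualApprox {S L : Type*} [Fintype S] {A : ProbAutomaton S L}
    {d : S × S → unitInterval} (hd : d = A.bisimFun d) {M : Set (S × S)}
    (h : A.SelfClosed d M) : M ⊆ dualApprox A.bisimFun d M := by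
  rintro ⟨s, t⟩ hst
  have hM := h.subset_topSet
  obtain ⟨⟨hl, hpos⟩, h2, h3⟩ := h s t hst
  -- This `θ` lies below `minTop d`, so that nothing is truncated on `M`, and below every nonzero
  -- gap between `d (s, t)` and a one-sided minimum.
  obtain ⟨θ, hθ, hT⟩ := exists_pos_lowerBound
    (((Set.finite_range fun p : A.D =>
        tsub (d (s, t)) (⨅ q ∈ A.η t, kantorovich A.D d (p, q))).union
      (Set.finite_range fun q : A.D =>
        tsub (d (s, t)) (⨅ p ∈ A.η s, kantorovich A.D d (p, q)))).insert (minTop d))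
  have hle : ∀ x ∈ M, θ ≤ d x := fun x hx =>
    (hT _ (Or.inl rfl) (minTop_pos d).ne').trans (minTop_le (hM hx))
  have hdst : d (s, t) = hausdorff (kantorovich A.D d) (A.η s, A.η t) := by
    rw [← A.bisimFun_of_label_eq d hl, ← hd]
  have hsup := hdst.ge
  simp only [hausdorff, max_le_iff, iSup_le_iff] at hsup
  refine A.nonExpansive_bisimFun.mem_dualApprox hM hθ ⟨by rw [← hd]; exact hM hst, ?_⟩
  rw [le_tsub_iff hθ, ← hd, A.bisimFun_of_label_eq _ hl, hausdorff_add_le_iff (hle _ hst)]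
  refine ⟨fun p hp => ?_, fun q hq => ?_⟩
  · exact iInf_kantorovich_decrease_add_le (k := fun q => (p, q)) hle (hsup.1 p hp)
      (hT _ (Or.inr (Or.inl ⟨p, rfl⟩))) (h2 p hp)
  · exact iInf_kantorovich_decrease_add_le (k := fun p => (p, q)) hle (hsup.2 q hq)
      (hT _ (Or.inr (Or.inr ⟨q, rfl⟩))) (h3 q hq)

end ProbAutomaton

end BisimMetric

theorem mainTheorem8 {S L : Type*} [Fintype S] (A : BisimMetric.ProbAutomaton S L) :
    -- the function of the automaton decomposes as stated and is non-expansive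
    (A.bisimFun =
      BisimMetric.maxRel (fun (y : (S × S) ⊕ (S × S)) (z : S × S) => Sum.elim id id y = z) ∘
        BisimMetric.disjUnion
          (BisimMetric.reindex (Prod.map A.η A.η) ∘ BisimMetric.hausdorff ∘
            BisimMetric.kantorovich A.D)
          (BisimMetric.const A.labelDist)) ∧
    BisimMetric.NonExpansive A.bisimFun ∧
    -- at a fixpoint, its dual approximation is an endo-function on the subsets of the set of
    -- pairs of positive distance, and its post-fixpoints are the self-closed relations
    ∀ d : S × S → unitInterval, d = A.bisimFun d →
      BisimMetric.topSet d = {x | 0 < d x} ∧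
      (∀ M ⊆ BisimMetric.topSet d,
        BisimMetric.dualApprox A.bisimFun d M ⊆ BisimMetric.topSet d) ∧
      ∀ M : Set (S × S),
        A.SelfClosed d M ↔
          M ⊆ BisimMetric.topSet d ∧ M ⊆ BisimMetric.dualApprox A.bisimFun d M := by
  refine ⟨A.bisimFun_eq_maxRel, A.nonExpansive_bisimFun, fun d hd => ⟨?_, fun M _ x hx => ?_,
    fun M => ⟨fun h => ⟨h.subset_topSet, h.subset_dualApprox hd⟩,
      fun h => A.selfClosed_of_subset_dualApprox hd h.1 h.2⟩⟩⟩
  · ext x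
    exact ⟨fun h => lt_of_le_of_ne unitInterval.nonneg' (Ne.symm h), fun h => h.ne'⟩
  · have hx' := hx.1
    rwa [← hd] at hx'
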